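/- Let $n\in\{1,2,3,\dots\}\cup\{\omega\}$, and put $N=\{0,\dots,n-1\}$ if $n$ is finite and $N=\{0,1,2,\dots\}$ if $n=\omega$. Let $X=(\{0,1\}^{\mathbb N})^{N}$ be the $n$-dimensional Cantor cube. A box is given by a finite binary word $w_i$ for each $i\in N$; its points are the $x\in X$ such that $x_i$ begins with $w_i$ for all $i\in N$. A pattern is a finite collection of boxes obtained from the undivided cube $X$ by finitely many steps, each of which replaces one box by its two halves in some coordinate direction $i$ (that is, $w_i$ is replaced by $w_i0$ and by $w_i1$). A numbered pattern is a pattern with its boxes numbered $0,\dots,r-1$. A pair $(P,Q)$ of numbered patterns with the same number $r$ of boxes defines the bijection of $X$ that, for each $k<r$, carries the $k$-th box of $P$ to the $k$-th box of $Q$ by the canonical affine map, that is, by exchanging the prefix in every coordinate. The higher dimensional Thompson group $nV$ is the group of all bijections of $X$ that arise in this way, under composition. A transposition is a bijection given by a pair $(P,Q)$ in which $P$ and $Q$ are the same pattern, numbered identically except that two of the numbers are switched. Theorem. For every $n\in\{1,2,3,\dots,\omega\}$, the group $nV$ is generated by its transpositions, and it is simple. -/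

import Mathlib

namespace HigherThompson

/-- The Cantor cube: a point has, in each coordinate `i : ι`, an infinite binary word (the binary
expansion of that coordinate). -/
abbrev CantorCube (ι : Type) : Type := ι → Stream' Bool

/-- A dyadic rectangle (box), given by a finite binary word in each coordinate: the points of the
box are those whose `i`-th coordinate starts with the `i`-th word. -/
abbrev Box (ι : Type) : Type := ι → List Bool

namespace Box

variable {ι : Type}

/-- The whole cube. -/
def whole : Box ι := fun _ => []

/-- The canonical affine map from the whole cube onto the box `R`: in each coordinate the word of
`R` is put in front. -/
def embed (R : Box ι) (x : CantorCube ι) : CantorCube ι := fun i => R i ++ₛ x i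

/-- The lower (`b = false`) or upper (`b = true`) half of `R` when `R` is cut in half across the
`i`-th coordinate axis. -/
def half [DecidableEq ι] (R : Box ι) (i : ι) (b : Bool) : Box ι :=
  Function.update R i (R i ++ [b])

end Box

open Box

section Patterns

variable {ι : Type} [DecidableEq ι]

/-- Patterns: the finite collections of boxes that arise from the undivided cube by repeatedly
replacing one box by its two halves in some coordinate direction. -/
inductive IsPattern : Multiset (Box ι) → Prop
  | whole : IsPattern {Box.whole}
  | halve (R : Box ι) (P : Multiset (Box ι)) (i : ι) :
      IsPattern (R ::ₘ P) → IsPattern (R.half i false ::ₘ R.half i true ::ₘ P)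

/-- `P` lists the boxes of a pattern, numbered by `0, …, r - 1`. -/
def IsNumberedPattern {r : ℕ} (P : Fin r → Box ι) : Prop :=
  IsPattern (Multiset.map P Finset.univ.val)

/-- `f` is the map given by the pair `(P, Q)`: it carries the `k`-th box of `P` to the
`k`-th box of `Q` by the canonical affine map between these boxes. -/
def IsGivenBy (f : Equiv.Perm (CantorCube ι)) {r : ℕ} (P Q : Fin r → Box ι) : Prop :=
  ∀ k x, f ((P k).embed x) = (Q k).embed x

/-- `f` is given by some pair of numbered patterns with equally many boxes. -/
def IsPatternMap (f : Equiv.Perm (CantorCube ι)) : Prop :=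
  ∃ (r : ℕ) (P Q : Fin r → Box ι), IsNumberedPattern P ∧ IsNumberedPattern Q ∧ IsGivenBy f P Q

/-- Transpositions: the maps given by a pair of identical patterns that are numbered identically
except for a switch of two of the numbers. -/
def IsTransposition (f : Equiv.Perm (CantorCube ι)) : Prop :=
  ∃ (r : ℕ) (P : Fin r → Box ι) (a b : Fin r), IsNumberedPattern P ∧ a ≠ b ∧
    IsGivenBy f P (P ∘ Equiv.swap a b)

/-! Helper facts: the maps given by pairs of patterns form a group. -/

theorem embed_half (R : Box ι) (i : ι) (b : Bool) (x : CantorCube ι) :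
    (R.half i b).embed x = R.embed ((Box.whole.half i b).embed x) := by
  funext j
  by_cases h : j = i
  · subst h
    simp [embed, half, Box.whole, Stream'.append_append_stream]
  · simp [embed, half, Box.whole, h]

theorem half_comm (R : Box ι) {i j : ι} (h : i ≠ j) (b c : Bool) :
    (R.half i b).half j c = (R.half j c).half i b := by
  simp [half, h, h.symm, Function.update_comm h]

/-- `Refines P Q`: `Q` arises from `P` by repeated halving. -/
inductive Refines (P : Multiset (Box ι)) : Multiset (Box ι) → Prop
  | refl : Refines P P
  | halve (R : Box ι) (Q : Multiset (Box ι)) (i : ι) :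
      Refines P (R ::ₘ Q) → Refines P (R.half i false ::ₘ R.half i true ::ₘ Q)

theorem Refines.trans {P Q S : Multiset (Box ι)} (h : Refines P Q) (h' : Refines Q S) :
    Refines P S := by
  induction h' with
  | refl => exact h
  | halve R Q i _ ih => exact .halve R Q i ih

theorem Refines.add {P Q : Multiset (Box ι)} (h : Refines P Q) (S : Multiset (Box ι)) :
    Refines (P + S) (Q + S) := by
  induction h with
  | refl => exact .refl
  | halve R Q i _ ih =>
    rw [Multiset.cons_add] at ih
    simpa [Multiset.cons_add] using Refines.halve R (Q + S) i ih

theorem Refines.cons {P Q : Multiset (Box ι)} (h : Refines P Q) (R : Box ι) :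
    Refines (R ::ₘ P) (R ::ₘ Q) := by
  have := h.add {R}
  simpa [add_comm _ ({R} : Multiset (Box ι)), Multiset.singleton_add] using this

theorem isPattern_iff_refines {P : Multiset (Box ι)} :
    IsPattern P ↔ Refines {Box.whole} P := by
  constructor
  · intro h
    induction h with
    | whole => exact .refl
    | halve R P i _ ih => exact .halve R P i ih
  · intro h
    induction h with
    | refl => exact .whole
    | halve R P i _ ih => exact .halve R P i ih

/-- Halve every box of `P` in direction `i`. -/
def halveAll (i : ι) (P : Multiset (Box ι)) : Multiset (Box ι) :=
  P.map (fun R => R.half i false) + P.map (fun R => R.half i true)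

theorem halveAll_cons (i : ι) (R : Box ι) (P : Multiset (Box ι)) :
    halveAll i (R ::ₘ P) = R.half i false ::ₘ R.half i true ::ₘ halveAll i P := by
  simp only [halveAll, Multiset.map_cons, Multiset.cons_add, Multiset.add_cons]
  rw [Multiset.cons_swap]

theorem refines_halveAll (i : ι) (P : Multiset (Box ι)) : Refines P (halveAll i P) := by
  induction P using Multiset.induction_on with
  | empty => exact .refl
  | cons R P ih =>
    rw [halveAll_cons]
    exact .halve _ _ _ (ih.cons R)

theorem halveAll_comm (i j : ι) (P : Multiset (Box ι)) :
    halveAll i (halveAll j P) = halveAll j (halveAll i P) := by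
  by_cases h : i = j
  · rw [h]
  · simp only [halveAll, Multiset.map_add, Multiset.map_map, Function.comp_def, half_comm _ h]
    abel

theorem Refines.halveAll {P Q : Multiset (Box ι)} (h : Refines P Q) (i : ι) :
    Refines (halveAll i P) (halveAll i Q) := by
  induction h with
  | refl => exact .refl
  | halve R Q j _ ih =>
    refine ih.trans ?_
    simp only [halveAll_cons]
    generalize HigherThompson.halveAll i Q = S
    have h1 : Refines (R.half i false ::ₘ R.half i true ::ₘ S)
        ((R.half i false).half j false ::ₘ (R.half i false).half j true ::ₘ
          R.half i true ::ₘ S) := .halve _ _ _ .refl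
    have h2 := h1.trans (((Refines.halve (R.half i true) S j .refl).cons _).cons _)
    by_cases hij : i = j
    · subst hij
      exact h2
    · rw [half_comm R hij, half_comm R hij, half_comm R hij, half_comm R hij] at h2
      convert h2 using 2
      rw [Multiset.cons_swap]

/-- Halve everything successively in the directions of the list. -/
def grid (s : List ι) (P : Multiset (Box ι)) : Multiset (Box ι) := s.foldr halveAll P

theorem refines_grid (s : List ι) (P : Multiset (Box ι)) : Refines P (grid s P) := by
  induction s with
  | nil => exact .refl
  | cons i s ih => exact ih.trans (refines_halveAll i _)

theorem Refines.grid {P Q : Multiset (Box ι)} (h : Refines P Q) (s : List ι) :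
    Refines (grid s P) (grid s Q) := by
  induction s with
  | nil => exact h
  | cons i s ih => exact ih.halveAll i

theorem grid_halveAll (s : List ι) (i : ι) (P : Multiset (Box ι)) :
    grid s (halveAll i P) = halveAll i (grid s P) := by
  induction s with
  | nil => rfl
  | cons j s ih =>
    change halveAll j (grid s _) = halveAll i (halveAll j (grid s P))
    rw [ih, halveAll_comm]

theorem grid_comm (s t : List ι) (P : Multiset (Box ι)) :
    grid s (grid t P) = grid t (grid s P) := by
  induction s with
  | nil => rfl
  | cons j s ih =>
    change halveAll j (grid s _) = grid t (halveAll j (grid s P))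
    rw [ih, grid_halveAll]

theorem IsPattern.exists_grid {P : Multiset (Box ι)} (h : IsPattern P) :
    ∃ s : List ι, Refines P (grid s {Box.whole}) := by
  induction h with
  | whole => exact ⟨[], .refl⟩
  | halve R P i _ ih =>
    obtain ⟨s, hs⟩ := ih
    refine ⟨i :: s, Refines.trans ?_ (hs.halveAll i)⟩
    rw [halveAll_cons]
    exact ((refines_halveAll i P).cons _).cons _

theorem IsPattern.exists_common {P Q : Multiset (Box ι)} (hP : IsPattern P) (hQ : IsPattern Q) :
    ∃ W, Refines P W ∧ Refines Q W := by
  obtain ⟨s, hs⟩ := hP.exists_grid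
  obtain ⟨t, ht⟩ := hQ.exists_grid
  refine ⟨grid s (grid t {Box.whole}), hs.trans ((refines_grid t _).grid s), ?_⟩
  rw [grid_comm]
  exact ht.trans ((refines_grid s _).grid t)

/-- `f` carries the first box of each pair in `D` canonically onto the second. -/
def Carries (f : Equiv.Perm (CantorCube ι)) (D : Multiset (Box ι × Box ι)) : Prop :=
  ∀ p ∈ D, ∀ x, f (p.1.embed x) = p.2.embed x

theorem isPatternMap_iff (f : Equiv.Perm (CantorCube ι)) :
    IsPatternMap f ↔ ∃ D : Multiset (Box ι × Box ι),
      IsPattern (D.map Prod.fst) ∧ IsPattern (D.map Prod.snd) ∧ Carries f D := by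
  constructor
  · rintro ⟨r, P, Q, hP, hQ, hf⟩
    refine ⟨Multiset.map (fun k => (P k, Q k)) Finset.univ.val, ?_, ?_, ?_⟩
    · rw [Multiset.map_map]
      exact hP
    · rw [Multiset.map_map]
      exact hQ
    · intro p hp
      obtain ⟨k, -, rfl⟩ := Multiset.mem_map.1 hp
      exact hf k
  · rintro ⟨D, h1, h2, h⟩
    induction D using Quotient.inductionOn with | _ l
    have key : Multiset.map l.get Finset.univ.val = (l : Multiset (Box ι × Box ι)) := by
      rw [Fin.univ_val_map, List.ofFn_get]
    refine ⟨l.length, fun k => (l.get k).1, fun k => (l.get k).2, ?_, ?_, ?_⟩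
    · change IsPattern (Multiset.map (Prod.fst ∘ l.get) _)
      rw [← Multiset.map_map, key]
      exact h1
    · change IsPattern (Multiset.map (Prod.snd ∘ l.get) _)
      rw [← Multiset.map_map, key]
      exact h2
    · intro k
      exact h (l.get k) (List.get_mem l k)

theorem IsPatternMap.one : IsPatternMap (1 : Equiv.Perm (CantorCube ι)) :=
  (isPatternMap_iff _).2 ⟨{(Box.whole, Box.whole)}, by simpa using .whole, by simpa using .whole,
    by intro p hp; simp_all⟩

theorem IsPatternMap.inv {f : Equiv.Perm (CantorCube ι)} (hf : IsPatternMap f) :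
    IsPatternMap f⁻¹ := by
  obtain ⟨r, P, Q, hP, hQ, h⟩ := hf
  refine ⟨r, Q, P, hQ, hP, fun k x => ?_⟩
  rw [← h k x]
  simp

theorem Carries.refine_snd {f : Equiv.Perm (CantorCube ι)} {D : Multiset (Box ι × Box ι)}
    (h : Carries f D) {W : Multiset (Box ι)} (hW : Refines (D.map Prod.snd) W) :
    ∃ E : Multiset (Box ι × Box ι), E.map Prod.snd = W ∧
      Refines (D.map Prod.fst) (E.map Prod.fst) ∧ Carries f E := by
  induction hW with
  | refl => exact ⟨D, rfl, .refl, h⟩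
  | halve R Q i _ ih =>
    obtain ⟨E, hE, hr, hc⟩ := ih
    obtain ⟨p, hp, hpR⟩ := Multiset.mem_map.1
      (show R ∈ E.map Prod.snd by rw [hE]; exact Multiset.mem_cons_self _ _)
    obtain ⟨E, rfl⟩ := Multiset.exists_cons_of_mem hp
    obtain ⟨A, B⟩ := p
    obtain rfl : B = R := hpR
    rw [Multiset.map_cons, Multiset.cons_inj_right] at hE
    rw [Multiset.map_cons] at hr
    refine ⟨(A.half i false, B.half i false) ::ₘ (A.half i true, B.half i true) ::ₘ E,
      by simp [hE], by simpa using hr.trans (.halve _ _ i .refl), ?_⟩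
    have hAB := hc (A, B) (Multiset.mem_cons_self _ _)
    intro q hq x
    simp only [Multiset.mem_cons] at hq
    rcases hq with rfl | rfl | hq
    · simp only [embed_half A, embed_half B]
      exact hAB _
    · simp only [embed_half A, embed_half B]
      exact hAB _
    · exact hc q (Multiset.mem_cons_of_mem hq) x

theorem Carries.refine_fst {f : Equiv.Perm (CantorCube ι)} {D : Multiset (Box ι × Box ι)}
    (h : Carries f D) {W : Multiset (Box ι)} (hW : Refines (D.map Prod.fst) W) :
    ∃ E : Multiset (Box ι × Box ι), E.map Prod.fst = W ∧
      Refines (D.map Prod.snd) (E.map Prod.snd) ∧ Carries f E := by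
  have h' : Carries f⁻¹ (D.map Prod.swap) := by
    intro p hp x
    obtain ⟨q, hq, rfl⟩ := Multiset.mem_map.1 hp
    rw [Equiv.Perm.inv_eq_iff_eq]
    exact (h q hq x).symm
  obtain ⟨E, h1, h2, h3⟩ := h'.refine_snd (W := W) (by simpa [Multiset.map_map] using hW)
  refine ⟨E.map Prod.swap, by simpa [Multiset.map_map] using h1,
    by simpa [Multiset.map_map] using h2, ?_⟩
  intro p hp x
  obtain ⟨q, hq, rfl⟩ := Multiset.mem_map.1 hp
  have := h3 q hq x
  rw [Equiv.Perm.inv_eq_iff_eq] at this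
  exact this.symm

theorem Carries.comp {f g : Equiv.Perm (CantorCube ι)} {D E : Multiset (Box ι × Box ι)}
    (hf : Carries f D) (hg : Carries g E) (h : D.map Prod.snd = E.map Prod.fst) :
    ∃ F : Multiset (Box ι × Box ι), F.map Prod.fst = D.map Prod.fst ∧
      F.map Prod.snd = E.map Prod.snd ∧ Carries (g * f) F := by
  induction D using Multiset.induction_on generalizing E with
  | empty =>
    have : E = 0 := by simpa using h.symm
    subst this
    exact ⟨0, rfl, rfl, by intro p hp; simp at hp⟩
  | cons p D ih =>
    obtain ⟨q, hq, hpq⟩ := Multiset.mem_map.1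
      (show p.2 ∈ E.map Prod.fst by rw [← h]; simp)
    obtain ⟨E, rfl⟩ := Multiset.exists_cons_of_mem hq
    simp only [Multiset.map_cons, hpq, Multiset.cons_inj_right] at h
    obtain ⟨F, h1, h2, h3⟩ := ih (fun p hp => hf p (Multiset.mem_cons_of_mem hp))
      (fun p hp => hg p (Multiset.mem_cons_of_mem hp)) h
    refine ⟨(p.1, q.2) ::ₘ F, by simp [h1], by simp [h2], ?_⟩
    intro s hs x
    rcases Multiset.mem_cons.1 hs with rfl | hs
    · simp [hf p (Multiset.mem_cons_self _ _), ← hpq, hg q (Multiset.mem_cons_self _ _)]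
    · exact h3 s hs x

theorem IsPatternMap.mul {f g : Equiv.Perm (CantorCube ι)} (hg : IsPatternMap g)
    (hf : IsPatternMap f) : IsPatternMap (g * f) := by
  obtain ⟨D, hD1, hD2, hD⟩ := (isPatternMap_iff _).1 hf
  obtain ⟨E, hE1, hE2, hE⟩ := (isPatternMap_iff _).1 hg
  obtain ⟨W, hW1, hW2⟩ := hD2.exists_common hE1
  obtain ⟨D', hD'1, hD'2, hD'⟩ := hD.refine_snd hW1
  obtain ⟨E', hE'1, hE'2, hE'⟩ := hE.refine_fst hW2
  obtain ⟨F, h1, h2, h3⟩ := hD'.comp hE' (hD'1.trans hE'1.symm)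
  rw [isPattern_iff_refines] at hD1 hE2
  refine (isPatternMap_iff _).2 ⟨F, ?_, ?_, h3⟩
  · rw [h1, isPattern_iff_refines]
    exact hD1.trans hD'2
  · rw [h2, isPattern_iff_refines]
    exact hE2.trans hE'2

end Patterns

/-- The coordinates of the `n`-dimensional cube, `0 ≤ k < n`; for `n = ⊤` (that is, `n = ω`) all
natural numbers. -/
abbrev Coord (n : ℕ∞) : Type := {k : ℕ // (k : ℕ∞) < n}

/-- The higher dimensional Thompson group `nV`, `n = 1, 2, …, ω` (`ω` is `⊤ : ℕ∞`): the group
(under composition) of all self-maps of the `n`-dimensional Cantor cube that are given by pairs of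
numbered patterns. -/
def nV (n : ℕ∞) : Subgroup (Equiv.Perm (CantorCube (Coord n))) where
  carrier := {f | IsPatternMap f}
  mul_mem' := IsPatternMap.mul
  one_mem' := IsPatternMap.one
  inv_mem' := IsPatternMap.inv

end HigherThompson

/-!
Write `T` for the group generated by the transpositions (`transpositionGroup`).

A pattern cuts the cube into boxes, each identified with the whole cube, so the permutations of the
boxes of a pattern act on the cube, and they act by elements of `T`. Halving all boxes evenly
preserves the property of permuting the boxes of a pattern and eventually refines any given pattern;
therefore `T` is normalized by every map given by a pair of patterns (`IsPatternMap.conj_mem`).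

*Generation.* Modulo `T`, a map given by `(P, Q)` does not depend on the numbering. If `P` and `Q`
arise from `P'` and `Q'` by halving one box each, the numbering may be chosen so that the two halved
boxes correspond; if they are halved in the same direction, the map is then also given by
`(P', Q')`. If the directions `i` and `j` differ, a copy of the baker's map `i → j` in one box
remains. By induction on the number of boxes (`Carries.mem_transpositionGroup_of_isPattern`) it is
enough that baker's maps lie in `T` (`exists_baker`). Cutting into quarters shows that a baker's map
is, modulo `T`, the product of its copies in the two halves of the cube. Copies in disjoint boxes
are conjugate by a transposition, hence agree modulo `T`. So the class `β` of the copy in a half is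
the product of the classes of the copies in two quarters of the cube, each of which agrees with the
copy in the other half, that is `β = β ^ 2`, and `β` is trivial.

*Simplicity.* A nontrivial element `f` of a normal subgroup `N` moves some box `C` off itself
(`IsPatternMap.exists_displaced`), so `N` contains the copy in `C` of every commutator
(`inBox_commutator_mem`). The switch of the two halves of the cube is a commutator, so `N` contains
a transposition, of a pattern with at least three boxes. Transpositions of patterns with equally
many boxes are conjugate, and a transposition of a pattern with `r ≥ 3` boxes is one of a pattern
with `r + 1` boxes, so `N` contains all transpositions of patterns with sufficiently many boxes.
These generate `T` (`transpositionGroup_le_of_normal`).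
-/

namespace HigherThompson

open Box

section Basics

variable {ι : Type}

/-! ### Boxes and prefixes -/

theorem Box.embed_injective (R : Box ι) : Function.Injective R.embed := by
  intro x y h
  funext i
  exact Stream'.append_right_injective _ _ _ (congrFun h i)

@[simp]
theorem Box.embed_whole (x : CantorCube ι) : (Box.whole : Box ι).embed x = x := rfl

theorem Carries.inv {f : Equiv.Perm (CantorCube ι)} {D : Multiset (Box ι × Box ι)}
    (h : Carries f D) : Carries f⁻¹ (D.map Prod.swap) := by
  intro p hp x
  obtain ⟨q, hq, rfl⟩ := Multiset.mem_map.1 hp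
  rw [Equiv.Perm.inv_eq_iff_eq]
  exact (h q hq x).symm

theorem map_fst_swap (D : Multiset (Box ι × Box ι)) :
    (D.map Prod.swap).map Prod.fst = D.map Prod.snd := by
  simp [Multiset.map_map]

theorem map_snd_swap (D : Multiset (Box ι × Box ι)) :
    (D.map Prod.swap).map Prod.snd = D.map Prod.fst := by
  simp [Multiset.map_map]

variable [DecidableEq ι]

/-- The point obtained from `x` by writing the digit `b` in front of its `i`-th coordinate. -/
def prefixDigit (i : ι) (b : Bool) (x : CantorCube ι) : CantorCube ι :=
  (Box.whole.half i b).embed x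

theorem embed_half_eq (R : Box ι) (i : ι) (b : Bool) (x : CantorCube ι) :
    (R.half i b).embed x = R.embed (prefixDigit i b x) := embed_half R i b x

theorem prefixDigit_same (i : ι) (b : Bool) (x : CantorCube ι) :
    prefixDigit i b x i = Stream'.cons b (x i) := by
  simp [prefixDigit, Box.embed, Box.half, Box.whole, Stream'.cons_append_stream]

theorem prefixDigit_of_ne {i j : ι} (h : j ≠ i) (b : Bool) (x : CantorCube ι) :
    prefixDigit i b x j = x j := by
  simp [prefixDigit, Box.embed, Box.half, Box.whole, h]

theorem exists_prefixDigit (i : ι) (x : CantorCube ι) : ∃ b y, x = prefixDigit i b y := by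
  refine ⟨(x i).head, Function.update x i (x i).tail, ?_⟩
  funext j
  by_cases h : j = i
  · subst h
    rw [prefixDigit_same]
    simp [Stream'.eta]
  · rw [prefixDigit_of_ne h]
    simp [h]

theorem prefixDigit_injective {i : ι} {b c : Bool} {x y : CantorCube ι}
    (h : prefixDigit i b x = prefixDigit i c y) : b = c := by
  have := congrFun h i
  rw [prefixDigit_same, prefixDigit_same] at this
  exact (Stream'.cons_injective2 this).1

theorem prefixDigit_comm {i j : ι} (h : i ≠ j) (b c : Bool) (x : CantorCube ι) :
    prefixDigit i b (prefixDigit j c x) = prefixDigit j c (prefixDigit i b x) := by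
  unfold prefixDigit
  rw [← embed_half, ← embed_half, half_comm _ h]

theorem mem_range_embed_iff (R : Box ι) (i : ι) (x : CantorCube ι) :
    x ∈ Set.range R.embed ↔
      x ∈ Set.range (R.half i false).embed ∨ x ∈ Set.range (R.half i true).embed := by
  constructor
  · rintro ⟨y, rfl⟩
    obtain ⟨b, z, rfl⟩ := exists_prefixDigit i y
    cases b
    · exact .inl ⟨z, embed_half_eq ..⟩
    · exact .inr ⟨z, embed_half_eq ..⟩
  · rintro (⟨y, rfl⟩ | ⟨y, rfl⟩)
    · exact ⟨_, (embed_half_eq ..).symm⟩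
    · exact ⟨_, (embed_half_eq ..).symm⟩

theorem notMem_range_half (R : Box ι) (i : ι) (x : CantorCube ι)
    (h : x ∈ Set.range (R.half i false).embed) : x ∉ Set.range (R.half i true).embed := by
  obtain ⟨y, rfl⟩ := h
  rintro ⟨z, hz⟩
  rw [embed_half_eq, embed_half_eq] at hz
  exact absurd (prefixDigit_injective (R.embed_injective hz)) (by decide)

/-! ### A pattern is a partition of the cube -/

open scoped Classical in
theorem IsPattern.countP_eq_one {P : Multiset (Box ι)} (h : IsPattern P) (x : CantorCube ι) :
    P.countP (fun R => x ∈ Set.range R.embed) = 1 := by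
  induction h with
  | whole =>
    rw [← Multiset.cons_zero, Multiset.countP_cons_of_pos]
    · simp
    · exact ⟨x, rfl⟩
  | halve R P i _ ih =>
    rw [Multiset.countP_cons, mem_range_embed_iff R i] at ih
    rw [Multiset.countP_cons, Multiset.countP_cons]
    have := notMem_range_half R i x
    by_cases h1 : x ∈ Set.range (R.half i false).embed
    · simp only [h1, this h1, true_or, if_true, if_false] at ih ⊢
      omega
    · simp only [h1, false_or, if_false] at ih ⊢
      omega

theorem IsPattern.notMem_of_mem {A : Box ι} {P : Multiset (Box ι)} (h : IsPattern (A ::ₘ P))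
    {R : Box ι} (hR : R ∈ P) (x : CantorCube ι) : R.embed x ∉ Set.range A.embed := by
  classical
  intro hA
  have h1 := h.countP_eq_one (R.embed x)
  rw [Multiset.countP_cons, if_pos hA] at h1
  have h2 : 0 < P.countP (fun S => R.embed x ∈ Set.range S.embed) :=
    Multiset.countP_pos.2 ⟨R, hR, x, rfl⟩
  omega

theorem IsPattern.exists_mem {P : Multiset (Box ι)} (h : IsPattern P) (x : CantorCube ι) :
    ∃ R ∈ P, ∃ y, R.embed y = x := by
  classical
  have h1 := h.countP_eq_one x
  obtain ⟨R, hR, y, hy⟩ := Multiset.countP_pos.1 (h1 ▸ Nat.one_pos)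
  exact ⟨R, hR, y, hy⟩

theorem IsNumberedPattern.bijective {r : ℕ} {P : Fin r → Box ι} (h : IsNumberedPattern P) :
    Function.Bijective fun p : Fin r × CantorCube ι => (P p.1).embed p.2 := by
  classical
  constructor
  · rintro ⟨j, x⟩ ⟨k, y⟩ hxy
    have hc := h.countP_eq_one ((P j).embed x)
    rw [Multiset.countP_map, ← Finset.filter_val, Finset.card_val, Finset.card_eq_one] at hc
    obtain ⟨a, ha⟩ := hc
    have hj : j ∈ ({a} : Finset (Fin r)) := by rw [← ha]; simp
    have hk : k ∈ ({a} : Finset (Fin r)) := by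
      rw [← ha, Finset.mem_filter]
      exact ⟨Finset.mem_univ _, y, hxy.symm⟩
    rw [Finset.mem_singleton] at hj hk
    subst hj
    subst hk
    exact congrArg _ ((P k).embed_injective hxy)
  · intro x
    obtain ⟨R, hR, y, hy⟩ := IsPattern.exists_mem h x
    obtain ⟨k, -, rfl⟩ := Multiset.mem_map.1 hR
    exact ⟨(k, y), hy⟩

/-- The decomposition of the cube into the boxes of a numbered pattern, each of them identified
with the whole cube. -/
noncomputable def IsNumberedPattern.equiv {r : ℕ} {P : Fin r → Box ι} (h : IsNumberedPattern P) :
    Fin r × CantorCube ι ≃ CantorCube ι :=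
  Equiv.ofBijective _ h.bijective

theorem IsNumberedPattern.equiv_apply {r : ℕ} {P : Fin r → Box ι} (h : IsNumberedPattern P)
    (k : Fin r) (x : CantorCube ι) : h.equiv (k, x) = (P k).embed x := rfl

theorem IsNumberedPattern.equiv_symm_apply {r : ℕ} {P : Fin r → Box ι} (h : IsNumberedPattern P)
    (k : Fin r) (x : CantorCube ι) : h.equiv.symm ((P k).embed x) = (k, x) := by
  rw [Equiv.symm_apply_eq, h.equiv_apply]

theorem IsNumberedPattern.injective {r : ℕ} {P : Fin r → Box ι} (h : IsNumberedPattern P) :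
    Function.Injective P := by
  intro j k hjk
  have : h.equiv (j, fun _ => Stream'.const false) = h.equiv (k, fun _ => Stream'.const false) := by
    rw [h.equiv_apply, h.equiv_apply, hjk]
  simpa using h.equiv.injective this

theorem IsNumberedPattern.isGivenBy_unique {r : ℕ} {P Q : Fin r → Box ι}
    (h : IsNumberedPattern P) {f g : Equiv.Perm (CantorCube ι)} (hf : IsGivenBy f P Q)
    (hg : IsGivenBy g P Q) : f = g := by
  ext1 x
  obtain ⟨⟨k, y⟩, rfl⟩ := h.equiv.surjective x
  rw [h.equiv_apply, hf, hg]

theorem IsNumberedPattern.exists_isGivenBy {r : ℕ} {P Q : Fin r → Box ι}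
    (hP : IsNumberedPattern P) (hQ : IsNumberedPattern Q) :
    ∃ f : Equiv.Perm (CantorCube ι), IsGivenBy f P Q := by
  refine ⟨hP.equiv.symm.trans hQ.equiv, fun k x => ?_⟩
  rw [Equiv.trans_apply, hP.equiv_symm_apply, hQ.equiv_apply]

theorem exists_carries {D : Multiset (Box ι × Box ι)} (h1 : IsPattern (D.map Prod.fst))
    (h2 : IsPattern (D.map Prod.snd)) : ∃ f : Equiv.Perm (CantorCube ι), Carries f D := by
  induction D using Quotient.inductionOn with | _ l
  have key : Multiset.map l.get Finset.univ.val = (l : Multiset (Box ι × Box ι)) := by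
    rw [Fin.univ_val_map, List.ofFn_get]
  have hP : IsNumberedPattern fun k => (l.get k).1 := by
    change IsPattern (Multiset.map (Prod.fst ∘ l.get) _)
    rw [← Multiset.map_map, key]
    exact h1
  have hQ : IsNumberedPattern fun k => (l.get k).2 := by
    change IsPattern (Multiset.map (Prod.snd ∘ l.get) _)
    rw [← Multiset.map_map, key]
    exact h2
  obtain ⟨f, hf⟩ := hP.exists_isGivenBy hQ
  refine ⟨f, fun p hp x => ?_⟩
  obtain ⟨k, rfl⟩ := List.get_of_mem (Multiset.mem_coe.1 hp)
  exact hf k x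

/-! ### Permuting the boxes of one pattern -/

/-- The action of the permutations of the numbers on the cube: `σ` carries the `k`-th box of the
pattern to its `σ k`-th box. -/
noncomputable def IsNumberedPattern.blockPerm {r : ℕ} {P : Fin r → Box ι}
    (h : IsNumberedPattern P) : Equiv.Perm (Fin r) →* Equiv.Perm (CantorCube ι) :=
  MonoidHom.mk' (fun σ => h.equiv.permCongr (σ.prodCongr (Equiv.refl _))) <| by
    intro σ τ
    ext1 x
    simp [Equiv.permCongr_apply, Prod.map]

theorem IsNumberedPattern.isGivenBy_blockPerm {r : ℕ} {P : Fin r → Box ι}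
    (h : IsNumberedPattern P) (σ : Equiv.Perm (Fin r)) :
    IsGivenBy (h.blockPerm σ) P (P ∘ σ) := by
  intro k x
  simp only [blockPerm, MonoidHom.mk'_apply, Equiv.permCongr_apply]
  rw [h.equiv_symm_apply]
  exact h.equiv_apply _ _

theorem IsNumberedPattern.isTransposition_blockPerm {r : ℕ} {P : Fin r → Box ι}
    (h : IsNumberedPattern P) {a b : Fin r} (hab : a ≠ b) :
    IsTransposition (h.blockPerm (Equiv.swap a b)) :=
  ⟨r, P, a, b, h, hab, h.isGivenBy_blockPerm _⟩

/-- A map that permutes the boxes of a pattern comes from a permutation of their numbers. -/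
theorem Carries.exists_blockPerm {f : Equiv.Perm (CantorCube ι)} {D : Multiset (Box ι × Box ι)}
    (hf : Carries f D) (h : IsPattern (D.map Prod.fst)) (hD : D.map Prod.snd = D.map Prod.fst) :
    ∃ (P : Fin D.card → Box ι) (hP : IsNumberedPattern P) (σ : Equiv.Perm (Fin D.card)),
      f = hP.blockPerm σ := by
  induction D using Quotient.inductionOn with | _ l
  change ∃ (P : Fin l.length → Box ι) (hP : IsNumberedPattern P)
    (σ : Equiv.Perm (Fin l.length)), f = hP.blockPerm σ
  have key : Multiset.map l.get Finset.univ.val = (l : Multiset (Box ι × Box ι)) := by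
    rw [Fin.univ_val_map, List.ofFn_get]
  set P : Fin l.length → Box ι := fun k => (l.get k).1 with hPdef
  set Q : Fin l.length → Box ι := fun k => (l.get k).2 with hQdef
  have hP : IsNumberedPattern P := by
    change IsPattern (Multiset.map (Prod.fst ∘ l.get) _)
    rw [← Multiset.map_map, key]
    exact h
  have hPQ : Multiset.map Q Finset.univ.val = Multiset.map P Finset.univ.val := by
    change Multiset.map (Prod.snd ∘ l.get) _ = Multiset.map (Prod.fst ∘ l.get) _
    rw [← Multiset.map_map, ← Multiset.map_map, key]
    exact hD
  have hQ : IsNumberedPattern Q := by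
    unfold IsNumberedPattern
    rw [hPQ]
    exact hP
  have hrange : Set.range Q = Set.range P := by
    ext R
    have := congrArg (R ∈ ·) hPQ
    simpa using this
  let σ : Equiv.Perm (Fin l.length) := (Equiv.ofInjective Q hQ.injective).trans
    ((Equiv.setCongr hrange).trans (Equiv.ofInjective P hP.injective).symm)
  have hσ : P ∘ σ = Q := by
    funext k
    exact congrArg Subtype.val ((Equiv.ofInjective P hP.injective).apply_symm_apply
      (Equiv.setCongr hrange (Equiv.ofInjective Q hQ.injective k)))
  refine ⟨P, hP, σ, hP.isGivenBy_unique (Q := Q) (fun k x => ?_) ?_⟩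
  · exact hf (l.get k) (Multiset.mem_coe.2 (List.get_mem l k)) x
  · rw [← hσ]
    exact hP.isGivenBy_blockPerm σ

/-- The group generated by the transpositions. -/
def transpositionGroup (ι : Type) [DecidableEq ι] : Subgroup (Equiv.Perm (CantorCube ι)) :=
  Subgroup.closure {f | IsTransposition f}

theorem IsNumberedPattern.blockPerm_mem {r : ℕ} {P : Fin r → Box ι} (hP : IsNumberedPattern P)
    (S : Subgroup (Equiv.Perm (CantorCube ι)))
    (hS : ∀ a b, a ≠ b → hP.blockPerm (Equiv.swap a b) ∈ S) (σ : Equiv.Perm (Fin r)) :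
    hP.blockPerm σ ∈ S := by
  induction σ using Equiv.Perm.swap_induction_on with
  | one => simp [one_mem]
  | swap_mul σ a b hab ih =>
    rw [map_mul]
    exact mul_mem (hS a b hab) ih

/-- A map that permutes the boxes of a pattern is a product of transpositions. -/
theorem Carries.mem_transpositionGroup {f : Equiv.Perm (CantorCube ι)}
    {D : Multiset (Box ι × Box ι)} (hf : Carries f D) (h : IsPattern (D.map Prod.fst))
    (hD : D.map Prod.snd = D.map Prod.fst) : f ∈ transpositionGroup ι := by
  obtain ⟨P, hP, σ, rfl⟩ := hf.exists_blockPerm h hD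
  exact hP.blockPerm_mem _
    (fun a b hab => Subgroup.subset_closure (hP.isTransposition_blockPerm hab)) σ

theorem IsTransposition.exists_carries {f : Equiv.Perm (CantorCube ι)} (hf : IsTransposition f) :
    ∃ D : Multiset (Box ι × Box ι), IsPattern (D.map Prod.fst) ∧
      D.map Prod.snd = D.map Prod.fst ∧ Carries f D := by
  obtain ⟨r, P, a, b, hP, -, h⟩ := hf
  refine ⟨Multiset.map (fun k => (P k, P (Equiv.swap a b k))) Finset.univ.val, ?_, ?_, ?_⟩
  · rw [Multiset.map_map]
    exact hP
  · rw [Multiset.map_map, Multiset.map_map]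
    change Multiset.map (P ∘ Equiv.swap a b) _ = Multiset.map P _
    rw [← Multiset.map_map, Multiset.map_univ_val_equiv]
  · intro p hp x
    obtain ⟨k, -, rfl⟩ := Multiset.mem_map.1 hp
    exact h k x

/-! ### Refining a map and the pattern it permutes -/

theorem Carries.halveAll {f : Equiv.Perm (CantorCube ι)} {D : Multiset (Box ι × Box ι)}
    (h : Carries f D) (i : ι) :
    ∃ E : Multiset (Box ι × Box ι), E.map Prod.fst = halveAll i (D.map Prod.fst) ∧
      E.map Prod.snd = HigherThompson.halveAll i (D.map Prod.snd) ∧ Carries f E := by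
  refine ⟨D.map (fun p => (p.1.half i false, p.2.half i false)) +
    D.map (fun p => (p.1.half i true, p.2.half i true)), ?_, ?_, ?_⟩
  · simp [HigherThompson.halveAll, Multiset.map_map]
  · simp [HigherThompson.halveAll, Multiset.map_map]
  · intro p hp x
    rcases Multiset.mem_add.1 hp with hp | hp
    all_goals
      obtain ⟨q, hq, rfl⟩ := Multiset.mem_map.1 hp
      simp only [embed_half_eq]
      exact h q hq _

theorem Carries.grid {f : Equiv.Perm (CantorCube ι)} {D : Multiset (Box ι × Box ι)}
    (h : Carries f D) (s : List ι) :
    ∃ E : Multiset (Box ι × Box ι), E.map Prod.fst = grid s (D.map Prod.fst) ∧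
      E.map Prod.snd = HigherThompson.grid s (D.map Prod.snd) ∧ Carries f E := by
  induction s with
  | nil => exact ⟨D, rfl, rfl, h⟩
  | cons i s ih =>
    obtain ⟨E, h1, h2, h3⟩ := ih
    obtain ⟨F, h4, h5, h6⟩ := h3.halveAll i
    exact ⟨F, by rw [h4, h1]; rfl, by rw [h5, h2]; rfl, h6⟩

theorem IsPattern.refines {P Q : Multiset (Box ι)} (hP : IsPattern P) (h : Refines P Q) :
    IsPattern Q :=
  isPattern_iff_refines.2 ((isPattern_iff_refines.1 hP).trans h)

/-- A conjugate of a map that permutes the boxes of one pattern is a product of transpositions. If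
all boxes of the pattern are halved evenly, the map permutes the boxes of the refinement as well,
and after enough halvings the refinement is carried by `g` to a pattern. -/
theorem IsPatternMap.conj_mem {g t : Equiv.Perm (CantorCube ι)} (hg : IsPatternMap g)
    {D : Multiset (Box ι × Box ι)} (ht : Carries t D) (h : IsPattern (D.map Prod.fst))
    (hD : D.map Prod.snd = D.map Prod.fst) : g * t * g⁻¹ ∈ transpositionGroup ι := by
  obtain ⟨E, hE1, hE2, hE⟩ := (isPatternMap_iff g).1 hg
  obtain ⟨s, hs⟩ := hE1.exists_grid
  have hr : Refines (E.map Prod.fst) (grid s (D.map Prod.fst)) :=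
    hs.trans ((isPattern_iff_refines.1 h).grid s)
  obtain ⟨D', h1, h2, hD'⟩ := ht.grid s
  rw [hD, ← h1] at h2
  rw [← h1] at hr
  obtain ⟨E', h3, h4, hE'⟩ := hE.refine_fst hr
  obtain ⟨F, h5, h6, hF⟩ := hE'.inv.comp hD' (by rw [map_snd_swap, h3])
  obtain ⟨K, h7, h8, hK⟩ := hF.comp hE' (by rw [h6, h2, h3])
  rw [map_fst_swap] at h5
  rw [mul_assoc]
  refine hK.mem_transpositionGroup ?_ ?_
  · rw [h7, h5]
    exact hE2.refines h4
  · rw [h7, h8, h5]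

theorem transpositionGroup.conj_mem {g t : Equiv.Perm (CantorCube ι)} (hg : IsPatternMap g)
    (ht : t ∈ transpositionGroup ι) : g * t * g⁻¹ ∈ transpositionGroup ι := by
  have : transpositionGroup ι ≤ (transpositionGroup ι).comap (MulAut.conj g).toMonoidHom := by
    refine (Subgroup.closure_le _).2 fun t ht => ?_
    obtain ⟨D, h, hD, htD⟩ := ht.exists_carries
    exact hg.conj_mem htD h hD
  exact this ht

theorem transpositionGroup.isPatternMap {t : Equiv.Perm (CantorCube ι)}
    (ht : t ∈ transpositionGroup ι) : IsPatternMap t := by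
  induction ht using Subgroup.closure_induction with
  | mem t ht =>
    obtain ⟨D, h, hD, htD⟩ := IsTransposition.exists_carries ht
    exact (isPatternMap_iff t).2 ⟨D, h, hD ▸ h, htD⟩
  | one => exact .one
  | mul _ _ _ _ h1 h2 => exact h1.mul h2
  | inv _ _ h => exact h.inv

end Basics

section Copies

variable {ι : Type}

/-! ### Copies of maps inside a box -/

/-- The box that is carried to the box `R` of the whole cube by the canonical map from `C` onto
the whole cube. -/
def Box.sub (C R : Box ι) : Box ι := fun i => C i ++ R i

theorem Box.embed_sub (C R : Box ι) (x : CantorCube ι) :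
    (C.sub R).embed x = C.embed (R.embed x) := by
  funext i
  simp [Box.sub, Box.embed, Stream'.append_append_stream]

/-- The copy of a permutation of the cube inside the box `C`; it fixes all points outside `C`. -/
noncomputable def inBox (C : Box ι) : Equiv.Perm (CantorCube ι) →* Equiv.Perm (CantorCube ι) :=
  Equiv.Perm.viaEmbeddingHom ⟨C.embed, C.embed_injective⟩

theorem inBox_apply (C : Box ι) (f : Equiv.Perm (CantorCube ι)) (x : CantorCube ι) :
    inBox C f (C.embed x) = C.embed (f x) :=
  Equiv.Perm.viaEmbedding_apply f ⟨C.embed, C.embed_injective⟩ x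

theorem inBox_apply_of_notMem (C : Box ι) (f : Equiv.Perm (CantorCube ι)) {x : CantorCube ι}
    (hx : x ∉ Set.range C.embed) : inBox C f x = x :=
  Equiv.Perm.viaEmbedding_apply_of_notMem f ⟨C.embed, C.embed_injective⟩ x hx

theorem inBox_eq_conj {A B : Box ι} {g : Equiv.Perm (CantorCube ι)}
    (hg : ∀ x, g (A.embed x) = B.embed x) (f : Equiv.Perm (CantorCube ι)) :
    inBox B f = g * inBox A f * g⁻¹ := by
  ext1 x
  by_cases hx : x ∈ Set.range B.embed
  · obtain ⟨y, rfl⟩ := hx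
    have : g⁻¹ (B.embed y) = A.embed y := by rw [Equiv.Perm.inv_eq_iff_eq, hg]
    rw [Equiv.Perm.mul_apply, Equiv.Perm.mul_apply, this, inBox_apply, inBox_apply, hg]
  · have h' : g⁻¹ x ∉ Set.range A.embed := by
      rintro ⟨y, hy⟩
      exact hx ⟨y, by rw [← hg, hy]; simp⟩
    rw [Equiv.Perm.mul_apply, Equiv.Perm.mul_apply, inBox_apply_of_notMem _ _ hx,
      inBox_apply_of_notMem _ _ h']
    simp

variable [DecidableEq ι]

theorem Box.sub_half (C R : Box ι) (i : ι) (b : Bool) :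
    C.sub (R.half i b) = (C.sub R).half i b := by
  funext j
  by_cases h : j = i
  · subst h
    simp [Box.sub, Box.half]
  · simp [Box.sub, Box.half, h]

theorem inBox_half (R : Box ι) (i : ι) (b : Bool) (f : Equiv.Perm (CantorCube ι)) :
    inBox (R.half i b) f = inBox R (inBox (Box.whole.half i b) f) := by
  ext1 x
  by_cases hx : x ∈ Set.range R.embed
  · obtain ⟨y, rfl⟩ := hx
    rw [inBox_apply]
    by_cases hy : y ∈ Set.range ((Box.whole : Box ι).half i b).embed
    · obtain ⟨z, rfl⟩ := hy
      rw [inBox_apply, ← embed_half, ← embed_half, inBox_apply]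
    · rw [inBox_apply_of_notMem _ _ hy, inBox_apply_of_notMem]
      rintro ⟨z, hz⟩
      rw [embed_half] at hz
      exact hy ⟨z, R.embed_injective hz⟩
  · rw [inBox_apply_of_notMem _ _ hx, inBox_apply_of_notMem]
    rintro ⟨z, rfl⟩
    exact hx ⟨_, (embed_half R i b z).symm⟩

theorem IsPattern.sub {C : Box ι} {P S : Multiset (Box ι)} (hC : IsPattern (C ::ₘ P))
    (hS : IsPattern S) : IsPattern (S.map C.sub + P) := by
  induction hS with
  | whole =>
    have : C.sub Box.whole = C := by
      funext i
      simp [Box.sub, Box.whole]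
    simpa [this, Multiset.singleton_add] using hC
  | halve R S i _ ih =>
    rw [Multiset.map_cons, Multiset.cons_add] at ih
    simpa [Box.sub_half, Multiset.cons_add] using IsPattern.halve _ _ i ih

theorem Carries.inBox {C : Box ι} {P : Multiset (Box ι)} (hC : IsPattern (C ::ₘ P))
    {f : Equiv.Perm (CantorCube ι)} {D : Multiset (Box ι × Box ι)} (hf : Carries f D) :
    ∃ E : Multiset (Box ι × Box ι), E.map Prod.fst = (D.map Prod.fst).map C.sub + P ∧
      E.map Prod.snd = (D.map Prod.snd).map C.sub + P ∧ Carries (inBox C f) E := by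
  refine ⟨D.map (fun p => (C.sub p.1, C.sub p.2)) + P.map (fun R => (R, R)), ?_, ?_, ?_⟩
  · simp [Multiset.map_map]
  · simp [Multiset.map_map]
  · intro p hp x
    rcases Multiset.mem_add.1 hp with hp | hp
    · obtain ⟨q, hq, rfl⟩ := Multiset.mem_map.1 hp
      simp only [embed_sub]
      rw [inBox_apply, hf q hq]
    · obtain ⟨R, hR, rfl⟩ := Multiset.mem_map.1 hp
      exact inBox_apply_of_notMem _ _ (hC.notMem_of_mem hR x)

theorem IsPatternMap.inBox {C : Box ι} {P : Multiset (Box ι)} (hC : IsPattern (C ::ₘ P))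
    {f : Equiv.Perm (CantorCube ι)} (hf : IsPatternMap f) : IsPatternMap (inBox C f) := by
  obtain ⟨D, h1, h2, hD⟩ := (isPatternMap_iff f).1 hf
  obtain ⟨E, h3, h4, hE⟩ := hD.inBox hC
  exact (isPatternMap_iff _).2 ⟨E, h3 ▸ hC.sub h1, h4 ▸ hC.sub h2, hE⟩

theorem transpositionGroup.inBox {C : Box ι} {P : Multiset (Box ι)} (hC : IsPattern (C ::ₘ P))
    {f : Equiv.Perm (CantorCube ι)} (hf : f ∈ transpositionGroup ι) :
    inBox C f ∈ transpositionGroup ι := by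
  have : transpositionGroup ι ≤ (transpositionGroup ι).comap (HigherThompson.inBox C) := by
    refine (Subgroup.closure_le _).2 fun t ht => ?_
    obtain ⟨D, h, hD, htD⟩ := ht.exists_carries
    obtain ⟨E, h1, h2, hE⟩ := htD.inBox hC
    refine hE.mem_transpositionGroup ?_ ?_
    · rw [h1]
      exact hC.sub h
    · rw [h1, h2, hD]
  exact this hf

/-! ### Baker's maps -/

theorem IsPattern.halves (i : ι) :
    IsPattern {(Box.whole : Box ι).half i false, Box.whole.half i true} :=
  .halve Box.whole 0 i .whole

theorem IsPattern.quarters (i j : ι) :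
    IsPattern {((Box.whole : Box ι).half i false).half j false,
      (Box.whole.half i false).half j true, (Box.whole.half i true).half j false,
      (Box.whole.half i true).half j true} := by
  have h := (IsPattern.halves i).refines (refines_halveAll j _)
  rw [Multiset.insert_eq_cons, ← Multiset.cons_zero, halveAll_cons, halveAll_cons] at h
  exact h

/-- Two boxes of a common pattern are switched by a transposition. -/
theorem IsPattern.exists_swap {A B : Box ι} {P : Multiset (Box ι)}
    (h : IsPattern (A ::ₘ B ::ₘ P)) :
    ∃ t ∈ transpositionGroup ι, ∀ x, t (A.embed x) = B.embed x := by
  let D : Multiset (Box ι × Box ι) := (A, B) ::ₘ (B, A) ::ₘ P.map (fun R => (R, R))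
  have h1 : D.map Prod.fst = A ::ₘ B ::ₘ P := by simp [D, Multiset.map_map]
  have h2 : D.map Prod.snd = A ::ₘ B ::ₘ P := by
    simp [D, Multiset.map_map, Multiset.cons_swap]
  obtain ⟨t, ht⟩ := exists_carries (h1 ▸ h) (h2 ▸ h)
  exact ⟨t, ht.mem_transpositionGroup (h1 ▸ h) (h2.trans h1.symm),
    ht (A, B) (Multiset.mem_cons_self _ _)⟩

theorem IsPatternMap.comm_mem {f t : Equiv.Perm (CantorCube ι)} (hf : IsPatternMap f)
    (ht : t ∈ transpositionGroup ι) : f⁻¹ * (t * f * t⁻¹) ∈ transpositionGroup ι := by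
  have h := mul_mem (transpositionGroup.conj_mem hf.inv ht) (inv_mem ht)
  simpa [mul_assoc] using h

/-- Up to transpositions, copies of one map in two boxes of a pattern agree. -/
theorem IsPattern.inBox_inv_mul_inBox_mem {A B : Box ι} {P : Multiset (Box ι)}
    (h : IsPattern (A ::ₘ B ::ₘ P)) {f : Equiv.Perm (CantorCube ι)} (hf : IsPatternMap f) :
    (inBox A f)⁻¹ * inBox B f ∈ transpositionGroup ι := by
  obtain ⟨t, ht, htA⟩ := h.exists_swap
  rw [inBox_eq_conj htA]
  exact (hf.inBox h).comm_mem ht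

/-- Baker's maps, from the halves in the direction `i` to those in the direction `j`, are products
of transpositions: up to a transposition of two quarters of the cube, such a map is the product of
its copies in the two halves of the cube in the direction `j`. Copies in disjoint boxes agree up to
transpositions, so the class `β` of a copy in a half satisfies `β = β ^ 2`. -/
theorem exists_baker (i j : ι) :
    ∃ b ∈ transpositionGroup ι, ∀ a x, b (prefixDigit i a x) = prefixDigit j a x := by
  by_cases hij : i = j
  · subst hij
    exact ⟨1, one_mem _, fun _ _ => rfl⟩
  obtain ⟨b, hb⟩ := exists_carries
    (D := {((Box.whole : Box ι).half i false, Box.whole.half j false),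
      (Box.whole.half i true, Box.whole.half j true)})
    (by simpa [Multiset.insert_eq_cons] using IsPattern.halves i)
    (by simpa [Multiset.insert_eq_cons] using IsPattern.halves j)
  have hbG : IsPatternMap b := (isPatternMap_iff b).2 ⟨_,
    by simpa [Multiset.insert_eq_cons] using IsPattern.halves i,
    by simpa [Multiset.insert_eq_cons] using IsPattern.halves j, hb⟩
  have hb' : ∀ a x, b (prefixDigit i a x) = prefixDigit j a x := by
    intro a x
    cases a
    · exact hb (_, _) (Multiset.mem_cons_self _ _) x
    · exact hb (_, _) (Multiset.mem_cons_of_mem (Multiset.mem_singleton_self _)) x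
  refine ⟨b, ?_, hb'⟩
  -- `t` switches the quarters with digits `0, 1` and `1, 0` in the directions `i, j`.
  let D : Multiset (Box ι × Box ι) :=
    {(((Box.whole : Box ι).half i false).half j false,
        (Box.whole.half i false).half j false),
      ((Box.whole.half i false).half j true, (Box.whole.half i true).half j false),
      ((Box.whole.half i true).half j false, (Box.whole.half i false).half j true),
      ((Box.whole.half i true).half j true, (Box.whole.half i true).half j true)}
  have hD : D.map Prod.snd = D.map Prod.fst := by
    simp only [D, Multiset.insert_eq_cons, Multiset.map_cons, Multiset.map_singleton]
    rw [Multiset.cons_swap ((Box.whole.half i true).half j false)]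
  have hD1 : IsPattern (D.map Prod.fst) := by
    simpa [D, Multiset.insert_eq_cons] using IsPattern.quarters i j
  obtain ⟨t, ht⟩ := exists_carries hD1 (hD.symm ▸ hD1)
  have htT : t ∈ transpositionGroup ι := ht.mem_transpositionGroup hD1 hD
  have ht' : ∀ a c x, t (prefixDigit i a (prefixDigit j c x)) =
      prefixDigit i c (prefixDigit j a x) := by
    intro a c x
    have key : ∀ a c a' c', ((((Box.whole : Box ι).half i a).half j c),
        ((Box.whole.half i a').half j c')) ∈ D →
        t (prefixDigit i a (prefixDigit j c x)) = prefixDigit i a' (prefixDigit j c' x) := by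
      intro a c a' c' h
      have := ht _ h x
      simpa only [embed_half_eq, embed_whole] using this
    cases a <;> cases c <;> exact key _ _ _ _ (by simp [D])
  set x := inBox (Box.whole.half j false) b with hx
  set y := inBox (Box.whole.half j true) b with hy
  have hP := IsPattern.halves j
  have hP' : IsPattern ((Box.whole : Box ι).half j true ::ₘ {Box.whole.half j false}) := by
    rw [← Multiset.cons_zero, Multiset.cons_swap]
    exact hP
  have hyG : IsPatternMap y := hbG.inBox hP'
  have hbxy : b = x * y * t := by
    have hxy : ∀ a p, (x * y) (prefixDigit j a p) = prefixDigit j a (b p) := by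
      intro a p
      cases a
      · have : y (prefixDigit j false p) = prefixDigit j false p :=
          inBox_apply_of_notMem _ _ (hP'.notMem_of_mem (Multiset.mem_singleton_self _) p)
        rw [Equiv.Perm.mul_apply, this]
        exact inBox_apply _ _ _
      · have h1 : y (prefixDigit j true p) = prefixDigit j true (b p) := inBox_apply _ _ _
        rw [Equiv.Perm.mul_apply, h1]
        exact inBox_apply_of_notMem _ _ (hP.notMem_of_mem (Multiset.mem_singleton_self _) _)
    ext1 p
    obtain ⟨a, p, rfl⟩ := exists_prefixDigit i p
    obtain ⟨c, p, rfl⟩ := exists_prefixDigit j p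
    rw [Equiv.Perm.mul_apply, ht', hb', prefixDigit_comm hij, hxy, hb']
  set z := inBox ((Box.whole.half j false).half j false) b with hz
  set w := inBox ((Box.whole.half j false).half j true) b with hw
  have hxzw : x = z * w * inBox (Box.whole.half j false) t := by
    rw [hz, hw, inBox_half _ j false, inBox_half _ j true, ← hx, ← hy, ← map_mul, ← map_mul,
      ← hbxy]
  have ht0 : inBox (Box.whole.half j false) t ∈ transpositionGroup ι :=
    transpositionGroup.inBox hP htT
  -- The halves and quarters involved, arranged into patterns.
  have hQ : IsPattern ((Box.whole : Box ι).half j true ::ₘ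
      (Box.whole.half j false).half j false ::ₘ {(Box.whole.half j false).half j true}) := by
    rw [Multiset.cons_swap, ← Multiset.cons_zero, Multiset.cons_swap (Box.whole.half j true)]
    exact IsPattern.halve _ _ j hP
  have hQ' : IsPattern ((Box.whole : Box ι).half j true ::ₘ
      (Box.whole.half j false).half j true ::ₘ {(Box.whole.half j false).half j false}) := by
    rw [← Multiset.cons_zero,
      Multiset.cons_swap ((Box.whole.half j false).half j true)
        ((Box.whole.half j false).half j false)]
    exact hQ
  have hyx : y⁻¹ * x ∈ transpositionGroup ι := hP'.inBox_inv_mul_inBox_mem hbG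
  have hyz : y⁻¹ * z ∈ transpositionGroup ι := hQ.inBox_inv_mul_inBox_mem hbG
  have hyw : y⁻¹ * w ∈ transpositionGroup ι := hQ'.inBox_inv_mul_inBox_mem hbG
  have hyT : y ∈ transpositionGroup ι := by
    have h : y = (y⁻¹ * z)⁻¹ * (y⁻¹ * x) * (inBox (Box.whole.half j false) t)⁻¹ *
        (y⁻¹ * w)⁻¹ := by
      rw [hxzw]
      group
    rw [h]
    exact mul_mem (mul_mem (mul_mem (inv_mem hyz) hyx) (inv_mem ht0)) (inv_mem hyw)
  have hxT : x ∈ transpositionGroup ι := by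
    simpa using mul_mem hyT hyx
  rw [hbxy]
  exact mul_mem (mul_mem hxT hyT) htT

/-! ### Generation by transpositions -/

theorem exists_pairing {α : Type} {P Q : Multiset α} (h : P.card = Q.card) :
    ∃ D : Multiset (α × α), D.map Prod.fst = P ∧ D.map Prod.snd = Q := by
  induction P using Multiset.induction_on generalizing Q with
  | empty => exact ⟨0, rfl, by simpa [eq_comm] using h⟩
  | cons a P ih =>
    obtain ⟨b, Q, rfl⟩ : ∃ b Q', Q = b ::ₘ Q' := by
      obtain ⟨b, hb⟩ := Multiset.card_pos_iff_exists_mem.1 (by rw [← h]; simp : 0 < Q.card)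
      exact ⟨b, Multiset.exists_cons_of_mem hb⟩
    obtain ⟨D, h1, h2⟩ := ih (by simpa using h)
    exact ⟨(a, b) ::ₘ D, by simp [h1], by simp [h2]⟩

theorem IsPattern.card_pos {P : Multiset (Box ι)} (h : IsPattern P) : 0 < P.card := by
  obtain ⟨R, hR, -⟩ := h.exists_mem fun _ => Stream'.const false
  exact Multiset.card_pos_iff_exists_mem.2 ⟨R, hR⟩

/-- Induction on the number of boxes: if both patterns arise by a last halving, a map between the
patterns before this halving can be chosen to carry the halved box to the halved box. It differs
from the given map by a baker's map in one box and a permutation of boxes. -/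
theorem Carries.mem_transpositionGroup_of_isPattern {f : Equiv.Perm (CantorCube ι)}
    {D : Multiset (Box ι × Box ι)} (hf : Carries f D) (h1 : IsPattern (D.map Prod.fst))
    (h2 : IsPattern (D.map Prod.snd)) : f ∈ transpositionGroup ι := by
  induction hn : D.card using Nat.strong_induction_on generalizing f D with
  | _ n ih =>
  have hc1 : (D.map Prod.fst).card = n := by rw [Multiset.card_map, hn]
  have hc2 : (D.map Prod.snd).card = n := by rw [Multiset.card_map, hn]
  generalize hP : D.map Prod.fst = P at h1 hc1
  generalize hQ : D.map Prod.snd = Q at h2 hc2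
  cases h1 with
  | whole =>
    cases h2 with
    | whole => exact hf.mem_transpositionGroup (hP ▸ .whole) (hQ.trans hP.symm)
    | halve B Q j hQ' =>
      simp only [Multiset.card_cons, Multiset.card_singleton] at hc1 hc2
      omega
  | halve A P i hP' =>
    cases h2 with
    | whole =>
      simp only [Multiset.card_cons, Multiset.card_singleton] at hc1 hc2
      omega
    | halve B Q j hQ' =>
      simp only [Multiset.card_cons] at hc1 hc2
      obtain ⟨D', h3, h4⟩ := exists_pairing (show P.card = Q.card by omega)
      have h5 : IsPattern (((A, B) ::ₘ D').map Prod.fst) := by simpa [h3] using hP'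
      have h6 : IsPattern (((A, B) ::ₘ D').map Prod.snd) := by simpa [h4] using hQ'
      obtain ⟨g, hg⟩ := exists_carries h5 h6
      have hcard : D'.card = P.card := by rw [← h3, Multiset.card_map]
      have hgT : g ∈ transpositionGroup ι :=
        ih (((A, B) ::ₘ D').card) (by rw [Multiset.card_cons]; omega) hg h5 h6 rfl
      obtain ⟨b, hbT, hb⟩ := exists_baker i j
      let c := HigherThompson.inBox B b
      have hcT : c ∈ transpositionGroup ι := transpositionGroup.inBox hQ' hbT
      let E : Multiset (Box ι × Box ι) := (A.half i false, B.half j false) ::ₘ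
        (A.half i true, B.half j true) ::ₘ D'
      have hE1 : E.map Prod.fst = D.map Prod.fst := by simp [E, h3, hP]
      have hE2 : E.map Prod.snd = D.map Prod.snd := by simp [E, h4, hQ]
      have hE : Carries (c * g) E := by
        have key : ∀ a x, (c * g) ((A.half i a).embed x) = (B.half j a).embed x := by
          intro a x
          have := hg (A, B) (Multiset.mem_cons_self _ _)
          dsimp only at this
          rw [Equiv.Perm.mul_apply, embed_half_eq, this, embed_half_eq]
          change HigherThompson.inBox B b _ = _
          rw [inBox_apply, hb]
        intro p hp x
        simp only [E, Multiset.mem_cons] at hp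
        rcases hp with rfl | rfl | hp
        · exact key _ _
        · exact key _ _
        · rw [Equiv.Perm.mul_apply, hg p (Multiset.mem_cons_of_mem hp)]
          refine inBox_apply_of_notMem _ _ (hQ'.notMem_of_mem ?_ x)
          rw [← h4]
          exact Multiset.mem_map_of_mem _ hp
      obtain ⟨F, hF1, hF2, hF⟩ := hE.inv.comp hf (by rw [map_snd_swap, hE1])
      rw [map_fst_swap, hE2] at hF1
      have hfT : f * (c * g)⁻¹ ∈ transpositionGroup ι := by
        refine hF.mem_transpositionGroup ?_ (hF2.trans hF1.symm)
        rw [hF1, hQ]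
        exact .halve B Q j hQ'
      have h := mul_mem hfT (mul_mem hcT hgT)
      rwa [inv_mul_cancel_right] at h

theorem mem_transpositionGroup_iff {f : Equiv.Perm (CantorCube ι)} :
    f ∈ transpositionGroup ι ↔ IsPatternMap f := by
  refine ⟨transpositionGroup.isPatternMap, fun hf => ?_⟩
  obtain ⟨D, h1, h2, hD⟩ := (isPatternMap_iff f).1 hf
  exact hD.mem_transpositionGroup_of_isPattern h1 h2

end Copies

section Simplicity

variable {ι : Type}

/-! ### Commutators of copies in a displaced box -/

theorem Box.get_embed (R : Box ι) {i : ι} {p : ℕ} (hp : p < (R i).length)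
    (x y : CantorCube ι) : (R.embed x i).get p = (R.embed y i).get p := by
  simp only [Box.embed]
  rw [Stream'.get_append_left _ _ _ hp, Stream'.get_append_left _ _ _ hp]

variable [DecidableEq ι]

theorem le_length_of_mem_grid (m : ℕ) (i : ι) (P : Multiset (Box ι)) {R : Box ι}
    (hR : R ∈ grid (List.replicate m i) P) : m ≤ (R i).length := by
  induction m generalizing R with
  | zero => exact Nat.zero_le _
  | succ m ih =>
    change R ∈ halveAll i (grid (List.replicate m i) P) at hR
    rcases Multiset.mem_add.1 hR with hR | hR
    all_goals
      obtain ⟨S, hS, rfl⟩ := Multiset.mem_map.1 hR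
      have := ih hS
      simpa [Box.half] using this

theorem IsPatternMap.exists_displaced {f : Equiv.Perm (CantorCube ι)} (hf : IsPatternMap f)
    (hne : f ≠ 1) : ∃ (C : Box ι) (P : Multiset (Box ι)), IsPattern (C ::ₘ P) ∧
      ∀ x, f (C.embed x) ∉ Set.range C.embed := by
  obtain ⟨x, hx⟩ : ∃ x, f x ≠ x := by
    by_contra! h
    exact hne (Equiv.ext h)
  obtain ⟨i, hi⟩ := Function.ne_iff.1 hx
  obtain ⟨p, hp⟩ : ∃ p, (f x i).get p ≠ (x i).get p := by
    by_contra! h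
    exact hi (Stream'.ext h)
  obtain ⟨D, h1, -, hD⟩ := (isPatternMap_iff f).1 hf
  -- Halving in direction `i` until all boxes determine the digit at which `f x` and `x` differ.
  obtain ⟨E, h3, h4, hE⟩ := hD.grid (List.replicate (p + 1) i)
  have hpat : IsPattern (E.map Prod.fst) := h3 ▸ h1.refines (refines_grid _ _)
  obtain ⟨A, hA, y, rfl⟩ := hpat.exists_mem x
  obtain ⟨q, hq, rfl⟩ := Multiset.mem_map.1 hA
  have hA' : p < (q.1 i).length := by
    rw [h3] at hA
    exact le_length_of_mem_grid _ _ _ hA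
  have hB' : p < (q.2 i).length := by
    have := Multiset.mem_map_of_mem Prod.snd hq
    rw [h4] at this
    exact le_length_of_mem_grid _ _ _ this
  obtain ⟨P, hP⟩ := Multiset.exists_cons_of_mem hA
  refine ⟨q.1, P, hP ▸ hpat, ?_⟩
  rintro z ⟨w, hw⟩
  rw [hE q hq] at hw hp
  apply hp
  rw [q.2.get_embed hB' y z, ← hw, q.1.get_embed hA' w y]

/-- If `f` moves the box `C` off itself, a normal subgroup that contains `f` contains the copies
in `C` of all commutators: in `[g, [h, f]]`, for copies `g`, `h` in `C`, the part of the inner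
commutator that lives outside `C` cancels. -/
theorem inBox_commutator_mem {N : Subgroup (Equiv.Perm (CantorCube ι))}
    (hconj : ∀ g, IsPatternMap g → ∀ f ∈ N, g * f * g⁻¹ ∈ N)
    {f : Equiv.Perm (CantorCube ι)} (hf : f ∈ N) {C : Box ι} {P : Multiset (Box ι)}
    (hC : IsPattern (C ::ₘ P)) (hfC : ∀ x, f (C.embed x) ∉ Set.range C.embed)
    {g h : Equiv.Perm (CantorCube ι)} (hg : IsPatternMap g) (hh : IsPatternMap h) :
    inBox C (g * h * g⁻¹ * h⁻¹) ∈ N := by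
  simp only [map_mul, map_inv]
  set g' := inBox C g
  set h' := inBox C h
  have hcomm : Commute g' (f * h'⁻¹ * f⁻¹) := by
    refine Equiv.Perm.Disjoint.commute fun x => ?_
    by_cases hx : x ∈ Set.range C.embed
    · right
      have h1 : f⁻¹ x ∉ Set.range C.embed := by
        rintro ⟨y, hy⟩
        apply hfC y
        rw [hy]
        simpa using hx
      have h2 : h'⁻¹ (f⁻¹ x) = f⁻¹ x := by
        rw [Equiv.Perm.inv_eq_iff_eq]
        exact (inBox_apply_of_notMem _ _ h1).symm
      rw [Equiv.Perm.mul_apply, Equiv.Perm.mul_apply, h2]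
      simp
    · exact .inl (inBox_apply_of_notMem _ _ hx)
  have hm : h' * (f * h'⁻¹ * f⁻¹) ∈ N := by
    have := mul_mem (hconj h' (hh.inBox hC) f hf) (inv_mem hf)
    simpa only [mul_assoc] using this
  have key := mul_mem (hconj g' (hg.inBox hC) _ hm) (inv_mem hm)
  convert key using 1
  have h3 : g' * (f * h'⁻¹ * f⁻¹) * g'⁻¹ = f * h'⁻¹ * f⁻¹ := by
    rw [hcomm.eq, mul_inv_cancel_right]
  calc g' * h' * g'⁻¹ * h'⁻¹
      = g' * h' * g'⁻¹ * (f * h'⁻¹ * f⁻¹) * (h' * (f * h'⁻¹ * f⁻¹))⁻¹ := by group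
    _ = g' * h' * g'⁻¹ * (g' * (f * h'⁻¹ * f⁻¹) * g'⁻¹) * (h' * (f * h'⁻¹ * f⁻¹))⁻¹ := by
        rw [h3]
    _ = _ := by group

/-- The transposition of the two halves of the cube is a commutator of maps that permute four
quarters. -/
theorem exists_commutator_switching_halves (i : ι) :
    ∃ g h : Equiv.Perm (CantorCube ι), IsPatternMap g ∧ IsPatternMap h ∧
      ∀ a x, (g * h * g⁻¹ * h⁻¹) (prefixDigit i a x) = prefixDigit i (!a) x := by
  have hQ := IsPattern.quarters i i
  set q : Bool → Bool → Box ι := fun a c => (Box.whole.half i a).half i c with hq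
  have hqx : ∀ a c x, (q a c).embed x = prefixDigit i a (prefixDigit i c x) := by
    intro a c x
    simp only [q, embed_half_eq, embed_whole]
  change IsPattern {q false false, q false true, q true false, q true true} at hQ
  -- `g` switches the quarters with the words `00` and `10` in the direction `i`.
  let D : Multiset (Box ι × Box ι) := {(q false false, q true false),
    (q false true, q false true), (q true false, q false false), (q true true, q true true)}
  have hD1 : D.map Prod.fst = {q false false, q false true, q true false, q true true} := by
    simp [D]
  have hD2 : D.map Prod.snd = {q false false, q false true, q true false, q true true} := by
    simp only [D, Multiset.insert_eq_cons, Multiset.map_cons, Multiset.map_singleton]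
    rw [Multiset.cons_swap (q true false), Multiset.cons_swap (q true false),
      Multiset.cons_swap (q false true) (q false false)]
  obtain ⟨g, hg⟩ := exists_carries (hD1 ▸ hQ) (hD2 ▸ hQ)
  -- `h` switches `00` and `01`, and `10` and `11`.
  let E : Multiset (Box ι × Box ι) := {(q false false, q false true),
    (q false true, q false false), (q true false, q true true), (q true true, q true false)}
  have hE1 : E.map Prod.fst = {q false false, q false true, q true false, q true true} := by
    simp [E]
  have hE2 : E.map Prod.snd = {q false false, q false true, q true false, q true true} := by
    simp only [E, Multiset.insert_eq_cons, Multiset.map_cons, Multiset.map_singleton]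
    rw [Multiset.cons_swap (q false true), ← Multiset.cons_zero (q true false),
      Multiset.cons_swap (q true true), Multiset.cons_zero]
  obtain ⟨h, hh⟩ := exists_carries (hE1 ▸ hQ) (hE2 ▸ hQ)
  have hg' : ∀ a c x, g (prefixDigit i a (prefixDigit i c x)) =
      prefixDigit i (if c then a else !a) (prefixDigit i c x) := by
    intro a c x
    have key : ∀ a c a' c', (q a c, q a' c') ∈ D →
        g (prefixDigit i a (prefixDigit i c x)) = prefixDigit i a' (prefixDigit i c' x) := by
      intro a c a' c' hp
      have := hg _ hp x
      simpa only [hqx] using this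
    cases a <;> cases c <;> exact key _ _ _ _ (by simp [D])
  have hh' : ∀ a c x, h (prefixDigit i a (prefixDigit i c x)) =
      prefixDigit i a (prefixDigit i (!c) x) := by
    intro a c x
    have key : ∀ a c a' c', (q a c, q a' c') ∈ E →
        h (prefixDigit i a (prefixDigit i c x)) = prefixDigit i a' (prefixDigit i c' x) := by
      intro a c a' c' hp
      have := hh _ hp x
      simpa only [hqx] using this
    cases a <;> cases c <;> exact key _ _ _ _ (by simp [E])
  have hginv : g⁻¹ = g := by
    rw [inv_eq_iff_mul_eq_one]
    ext1 x
    obtain ⟨a, x, rfl⟩ := exists_prefixDigit i x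
    obtain ⟨c, x, rfl⟩ := exists_prefixDigit i x
    rw [Equiv.Perm.mul_apply, hg', hg']
    cases a <;> cases c <;> rfl
  have hhinv : h⁻¹ = h := by
    rw [inv_eq_iff_mul_eq_one]
    ext1 x
    obtain ⟨a, x, rfl⟩ := exists_prefixDigit i x
    obtain ⟨c, x, rfl⟩ := exists_prefixDigit i x
    rw [Equiv.Perm.mul_apply, hh', hh']
    cases c <;> rfl
  refine ⟨g, h, (isPatternMap_iff g).2 ⟨D, hD1 ▸ hQ, hD2 ▸ hQ, hg⟩,
    (isPatternMap_iff h).2 ⟨E, hE1 ▸ hQ, hE2 ▸ hQ, hh⟩, fun a x => ?_⟩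
  obtain ⟨c, x, rfl⟩ := exists_prefixDigit i x
  rw [hginv, hhinv, Equiv.Perm.mul_apply, Equiv.Perm.mul_apply, Equiv.Perm.mul_apply, hh', hg',
    hh', hg']
  cases a <;> cases c <;> rfl

/-! ### Transpositions of patterns with a given number of boxes -/

/-- `f` switches the boxes `A` and `B` and fixes all points of the boxes in `P`. -/
structure IsSwitch (f : Equiv.Perm (CantorCube ι)) (A B : Box ι) (P : Multiset (Box ι)) :
    Prop where
  left : ∀ x, f (A.embed x) = B.embed x
  right : ∀ x, f (B.embed x) = A.embed x
  fixes : ∀ R ∈ P, ∀ x, f (R.embed x) = R.embed x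

theorem IsSwitch.exists_blockPerm {f : Equiv.Perm (CantorCube ι)} {A B : Box ι}
    {P : Multiset (Box ι)} (hf : IsSwitch f A B P) (h : IsPattern (A ::ₘ B ::ₘ P)) :
    ∃ (Q : Fin (P.card + 2) → Box ι) (hQ : IsNumberedPattern Q) (a b : Fin (P.card + 2)),
      a ≠ b ∧ f = hQ.blockPerm (Equiv.swap a b) := by
  induction P using Quotient.inductionOn with | _ l
  have hQ : IsNumberedPattern (A :: B :: l).get := by
    unfold IsNumberedPattern
    rw [Fin.univ_val_map, List.ofFn_get]
    exact h
  refine ⟨_, hQ, (0 : Fin (l.length + 2)), (1 : Fin (l.length + 2)), by simp, ?_⟩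
  refine hQ.isGivenBy_unique (fun k x => ?_) (hQ.isGivenBy_blockPerm _)
  refine Fin.cases ?_ (fun k => Fin.cases ?_ (fun k => ?_) k) k
  · exact (hf.left x).trans (congrArg (fun k => ((A :: B :: l).get k).embed x)
      (Equiv.swap_apply_left (0 : Fin (l.length + 2)) 1).symm)
  · exact (hf.right x).trans (congrArg (fun k => ((A :: B :: l).get k).embed x)
      (Equiv.swap_apply_right (0 : Fin (l.length + 2)) 1).symm)
  · refine (hf.fixes (l.get k) (Multiset.mem_coe.2 (List.get_mem l k)) x).trans
      (congrArg (fun k => ((A :: B :: l).get k).embed x)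
      (Equiv.swap_apply_of_ne_of_ne (a := (0 : Fin (l.length + 2))) (b := 1)
        (x := k.succ.succ) ?_ ?_).symm)
    · exact Fin.succ_ne_zero _
    · intro hk
      exact Fin.succ_ne_zero k (Fin.succ_injective _ hk)

/-- Transpositions of patterns with the same number of boxes are conjugate. -/
theorem IsNumberedPattern.blockPerm_swap_mem {N : Subgroup (Equiv.Perm (CantorCube ι))}
    (hconj : ∀ g, IsPatternMap g → ∀ f ∈ N, g * f * g⁻¹ ∈ N) {r : ℕ} {P Q : Fin r → Box ι}
    (hP : IsNumberedPattern P) (hQ : IsNumberedPattern Q) {a b c d : Fin r} (hab : a ≠ b)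
    (hcd : c ≠ d) (h : hP.blockPerm (Equiv.swap a b) ∈ N) :
    hQ.blockPerm (Equiv.swap c d) ∈ N := by
  obtain ⟨σ, hσ⟩ := isConj_iff.1 (Equiv.Perm.isConj_swap hab hcd)
  obtain ⟨g, hg⟩ := hP.exists_isGivenBy hQ
  have key : g * hP.blockPerm (Equiv.swap a b) * g⁻¹ = hQ.blockPerm (Equiv.swap a b) := by
    refine hQ.isGivenBy_unique (fun k x => ?_) (hQ.isGivenBy_blockPerm _)
    have : g⁻¹ ((Q k).embed x) = (P k).embed x := by rw [Equiv.Perm.inv_eq_iff_eq, hg]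
    rw [Equiv.Perm.mul_apply, Equiv.Perm.mul_apply, this, hP.isGivenBy_blockPerm]
    exact hg _ x
  have h1 := hconj g ⟨r, P, Q, hP, hQ, hg⟩ _ h
  rw [key] at h1
  have h2 : IsPatternMap (hQ.blockPerm σ) := transpositionGroup.isPatternMap <|
    hQ.blockPerm_mem _ (fun _ _ hne => Subgroup.subset_closure (hQ.isTransposition_blockPerm hne)) σ
  have h3 := hconj _ h2 _ h1
  rwa [← map_inv, ← map_mul, ← map_mul, hσ] at h3

/-- A switch of two boxes of a pattern with at least three boxes is also such a switch for a
pattern with one more box, since a third box may be halved. -/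
theorem IsSwitch.exists_of_le (i : ι) {A B : Box ι} {P : Multiset (Box ι)}
    {f : Equiv.Perm (CantorCube ι)} (hs : IsSwitch f A B P) (h : IsPattern (A ::ₘ B ::ₘ P))
    (hP : 0 < P.card) {n : ℕ} (hn : P.card ≤ n) :
    ∃ P' : Multiset (Box ι), P'.card = n ∧ IsPattern (A ::ₘ B ::ₘ P') ∧ IsSwitch f A B P' := by
  induction n, hn using Nat.le_induction with
  | base => exact ⟨P, rfl, h, hs⟩
  | succ n hn ih =>
    obtain ⟨P', hc, hpat, hs'⟩ := ih
    obtain ⟨R, hR⟩ := Multiset.card_pos_iff_exists_mem.1 (by omega : 0 < P'.card)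
    obtain ⟨S, rfl⟩ := Multiset.exists_cons_of_mem hR
    refine ⟨R.half i false ::ₘ R.half i true ::ₘ S, by simpa using hc, ?_,
      hs'.left, hs'.right, ?_⟩
    · refine hpat.refines (((Refines.halve R S i .refl).cons B).cons A)
    · intro T hT x
      simp only [Multiset.mem_cons] at hT
      rcases hT with rfl | rfl | hT
      · rw [embed_half_eq]
        exact hs'.fixes R hR _
      · rw [embed_half_eq]
        exact hs'.fixes R hR _
      · exact hs'.fixes T (Multiset.mem_cons_of_mem hT) x

theorem le_card_grid (m : ℕ) (i : ι) {P : Multiset (Box ι)} (h : 0 < P.card) :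
    m < (grid (List.replicate m i) P).card := by
  induction m with
  | zero => exact h
  | succ m ih =>
    change m + 1 < (halveAll i (grid (List.replicate m i) P)).card
    simp only [halveAll, Multiset.card_add, Multiset.card_map]
    omega

/-! ### Simplicity -/

/-- A nontrivial normal subgroup contains a transposition of a pattern with at least three boxes,
hence all transpositions of patterns with sufficiently many boxes; every other transposition
becomes a product of such transpositions when its pattern is refined evenly. -/
theorem transpositionGroup_le_of_normal [Nonempty ι] {N : Subgroup (Equiv.Perm (CantorCube ι))}
    (hN : ∀ f ∈ N, IsPatternMap f) (hconj : ∀ g, IsPatternMap g → ∀ f ∈ N, g * f * g⁻¹ ∈ N)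
    {f : Equiv.Perm (CantorCube ι)} (hf : f ∈ N) (hne : f ≠ 1) : transpositionGroup ι ≤ N := by
  obtain ⟨i⟩ := ‹Nonempty ι›
  obtain ⟨C, P, hC, hfC⟩ := (hN f hf).exists_displaced hne
  obtain ⟨g, h, hg, hh, hu⟩ := exists_commutator_switching_halves i
  have hmem := inBox_commutator_mem hconj hf hC hfC hg hh
  set u := g * h * g⁻¹ * h⁻¹
  have hP : 0 < P.card := by
    by_contra h0
    obtain rfl : P = 0 := by simpa using h0
    obtain ⟨R, hR, y, hy⟩ := hC.exists_mem (f (C.embed fun _ => Stream'.const false))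
    obtain rfl : R = C := by simpa using hR
    exact hfC _ ⟨y, hy⟩
  have hswitch : IsSwitch (inBox C u) (C.half i false) (C.half i true) P := by
    refine ⟨fun x => ?_, fun x => ?_, fun R hR x => ?_⟩
    · rw [embed_half_eq, embed_half_eq, inBox_apply, hu]
      rfl
    · rw [embed_half_eq, embed_half_eq, inBox_apply, hu]
      rfl
    · exact inBox_apply_of_notMem _ _ (hC.notMem_of_mem hR x)
  have hlarge : ∀ {r : ℕ} {Q : Fin r → Box ι} (hQ : IsNumberedPattern Q) (c d : Fin r),
      P.card + 2 ≤ r → c ≠ d → hQ.blockPerm (Equiv.swap c d) ∈ N := by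
    intro r Q hQ c d hr hcd
    obtain ⟨P', hc, hpat, hs⟩ := hswitch.exists_of_le (n := r - 2) i
      (IsPattern.halve C P i hC) hP (by omega)
    obtain ⟨Q', hQ', a, b, hab, he⟩ := hs.exists_blockPerm hpat
    obtain rfl : r = P'.card + 2 := by omega
    exact hQ'.blockPerm_swap_mem hconj hQ hab hcd (he ▸ hmem)
  refine (Subgroup.closure_le _).2 fun t ht => ?_
  obtain ⟨D, h1, h2, hD⟩ := IsTransposition.exists_carries ht
  obtain ⟨E, h3, h4, hE⟩ := hD.grid (List.replicate (P.card + 2) i)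
  have hcard : P.card + 2 ≤ E.card := by
    rw [← Multiset.card_map Prod.fst E, h3]
    exact (le_card_grid _ i h1.card_pos).le
  obtain ⟨Q, hQ, σ, rfl⟩ := hE.exists_blockPerm (h3 ▸ h1.refines (refines_grid _ _))
    (by rw [h3, h4, h2])
  exact hQ.blockPerm_mem N (fun c d hcd => hlarge hQ c d hcard hcd) σ

end Simplicity

end HigherThompson

theorem mainTheorem2 (n : ℕ∞) (hn : 1 ≤ n) :
    Subgroup.closure
        {f : Equiv.Perm (HigherThompson.CantorCube (HigherThompson.Coord n)) |
          HigherThompson.IsTransposition f} = HigherThompson.nV n ∧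
      IsSimpleGroup (HigherThompson.nV n) := by
  open HigherThompson in
  have : Nonempty (Coord n) := ⟨⟨0, lt_of_lt_of_le (by simp) hn⟩⟩
  have hgen : transpositionGroup (Coord n) = nV n :=
    Subgroup.ext fun f => mem_transpositionGroup_iff
  refine ⟨hgen, { exists_pair_ne := ?_, eq_bot_or_eq_top_of_normal := ?_ }⟩
  · obtain ⟨i⟩ := this
    obtain ⟨g, h, hg, hh, hu⟩ := exists_commutator_switching_halves i
    refine ⟨⟨g * h * g⁻¹ * h⁻¹, ((hg.mul hh).mul hg.inv).mul hh.inv⟩, 1, fun heq => ?_⟩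
    have h1 := hu false fun _ => Stream'.const false
    have h2 : g * h * g⁻¹ * h⁻¹ = 1 := congrArg Subtype.val heq
    rw [h2] at h1
    exact absurd (prefixDigit_injective h1) (by decide)
  · intro N hN
    refine or_iff_not_imp_left.2 fun hbot => ?_
    obtain ⟨⟨f, hfG⟩, hf, hne⟩ := N.bot_or_exists_ne_one.resolve_left hbot
    have hle : transpositionGroup (Coord n) ≤ N.map (nV n).subtype := by
      refine transpositionGroup_le_of_normal (f := f) ?_ ?_ ⟨⟨f, hfG⟩, hf, rfl⟩ ?_
      · rintro _ ⟨g, -, rfl⟩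
        exact g.2
      · rintro g hg _ ⟨k, hk, rfl⟩
        exact ⟨⟨g, hg⟩ * k * ⟨g, hg⟩⁻¹, hN.conj_mem k hk ⟨g, hg⟩, rfl⟩
      · rintro rfl
        exact hne rfl
    refine eq_top_iff.2 fun g _ => ?_
    obtain ⟨k, hk, hkg⟩ := hle (hgen.ge g.2)
    have hkg' : k = g := Subtype.ext hkg
    rwa [← hkg']
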